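/- Let $G$ be a (possibly infinite) group and let $k,n$ be positive integers. For $x\in G$ write $x^G$ for the conjugacy class of $x$, and let $B_n(G)=\{x\in G : |x^G|\le n\}$. We say that $G$ satisfies the $(k,n)$-covering condition if there is a subset $S\subseteq G$ with $|S|\le k$ such that every commutator $[x,y]$, $x,y\in G$, lies in the product set $S\,B_n(G)=\{sb : s\in S,\ b\in B_n(G)\}$. Write $K'$ for the commutator subgroup of a group $K$. For all positive integers $k,n$ there is a number $C=C(k,n)$, depending only on $k$ and $n$, such that the following holds for every group $G$ satisfying the $(k,n)$-covering condition. There is a characteristic subgroup $B$ of $G'$ such that the index $[G':B]$ and the order $|B'|$ are finite and at most $C$, and such that the subgroup $T=C_B(B')$ (the centralizer of $B'$ in $B$) is a characteristic subgroup of $G'$, is nilpotent of class at most $2$, and has finite index at most $C$ in $G'$. (In particular $B$ and $T$ are also characteristic in $G$.) -/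

import Mathlib

/-- The set `B_n(G)` of all elements of `G` having at most `n` conjugates. -/
def smallClassSet (G : Type*) [Group G] (n : ℕ) : Set G :=
  {x | (conjugatesOf x).encard ≤ n}

open scoped Pointwise in
/-- The `(k, n)`-covering condition for commutators: there is a subset `S` of `G` with at most
`k` elements such that every commutator of `G` lies in the product set `S * B_n(G)`. -/
def CoveringCondition (G : Type*) [Group G] (k n : ℕ) : Prop :=
  ∃ S : Set G, S.encard ≤ k ∧ commutatorSet G ⊆ S * smallClassSet G n

/-! Write B_N for `smallClassSet G N`. For fixed e, a pigeonhole on the covering set S gives a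
subgroup D of index at most k with [d, e] ∈ B_N for all d ∈ D, where N depends only on k and n
(`CoveringCondition.exists_subgroup`). A maximality argument as in Neumann's theorem then places [d,
e], for d in a smaller subgroup of bounded index, in the centralizer of B_N modulo a normal subgroup
Q of bounded order (`almostCentral_of_commutator_mem`). This Q depends on e; induction on the bound
for |Q| makes it uniform (`exists_uniform_of_almostCentral`).

Let K be the intersection of that centralizer with ⟨B_N⟩. Every e commutes modulo K with a subgroup
of bounded index, so Neumann's theorem bounds |(G/K)'|, which is the index of K ∩ G' in G'; moreover
[K, K] ≤ Q. Finally K ∩ G' is replaced by the subgroup of G' generated by the elements with few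
conjugates, which is characteristic and obeys similar bounds. Centralizing the finite group B' costs
bounded index and leaves class at most 2. -/

section CommutatorCoverings

open Subgroup
open scoped Pointwise commutatorElement

/-! ### Subgroups of bounded index. -/

section IndexBounds

variable {G : Type*} [Group G]

/-- The subgroup `H` has finite index at most `c`. -/
def IndexLE (H : Subgroup G) (c : ℕ) : Prop :=
  H.index ≠ 0 ∧ H.index ≤ c

theorem IndexLE.finiteIndex {H : Subgroup G} {c : ℕ} (h : IndexLE H c) : H.FiniteIndex :=
  ⟨h.1⟩

theorem IndexLE.pos {H : Subgroup G} {c : ℕ} (h : IndexLE H c) : 0 < c :=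
  (Nat.pos_of_ne_zero h.1).trans_le h.2

theorem IndexLE.mono {H : Subgroup G} {c d : ℕ} (h : IndexLE H c) (hcd : c ≤ d) : IndexLE H d :=
  ⟨h.1, h.2.trans hcd⟩

theorem IndexLE.of_le {H K : Subgroup G} {c : ℕ} (h : IndexLE H c) (hHK : H ≤ K) :
    IndexLE K c := by
  have := h.finiteIndex
  exact ⟨fun h0 => h.1 (Nat.eq_zero_of_zero_dvd (h0 ▸ index_dvd_of_le hHK)),
    (index_antitone hHK).trans h.2⟩

theorem IndexLE.inf {H K : Subgroup G} {c d : ℕ} (h : IndexLE H c) (h' : IndexLE K d) :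
    IndexLE (H ⊓ K) (c * d) :=
  ⟨index_inf_ne_zero h.1 h'.1, index_inf_le.trans (Nat.mul_le_mul h.2 h'.2)⟩

theorem IndexLE.iInf {ι : Type*} [Finite ι] {f : ι → Subgroup G} {c s : ℕ}
    (h : ∀ i, IndexLE (f i) c) (hc : 0 < c) (hs : Nat.card ι ≤ s) :
    IndexLE (⨅ i, f i) (c ^ s) := by
  have := Fintype.ofFinite ι
  refine ⟨index_iInf_ne_zero fun i => (h i).1, (index_iInf_le f).trans ?_⟩
  refine (Finset.prod_le_pow_card _ _ c fun i _ => (h i).2).trans ?_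
  rw [Finset.card_univ, ← Nat.card_eq_fintype_card]
  exact Nat.pow_le_pow_right hc hs

theorem IndexLE.normalCore {H : Subgroup G} {c : ℕ} (h : IndexLE H c) :
    IndexLE H.normalCore c.factorial := by
  have := h.finiteIndex
  refine ⟨H.finiteIndex_normalCore.index_ne_zero, ?_⟩
  have hd : H.normalCore.index ∣ H.index.factorial := by
    rw [normalCore_eq_ker, index_ker, index_eq_card, ← Nat.card_perm]
    exact card_subgroup_dvd_card _
  exact (Nat.le_of_dvd (Nat.factorial_pos _) hd).trans (Nat.factorial_le h.2)

theorem IndexLE.subgroupOf {H : Subgroup G} {c : ℕ} (h : IndexLE H c) (K : Subgroup G) :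
    IndexLE (H.subgroupOf K) c := by
  have := h.finiteIndex
  refine ⟨(inferInstance : (H.subgroupOf K).FiniteIndex).index_ne_zero, le_trans ?_ h.2⟩
  rw [← relIndex_top_right H]
  exact relIndex_le_of_le_right le_top (by rw [relIndex_top_right H]; exact h.1)

/-- A colouring whose colour classes lie in single left cosets bounds the index. -/
theorem IndexLE.of_coloring {H : Subgroup G} {α : Type*} [Finite α] (c : G → α)
    (h : ∀ x y, c x = c y → x⁻¹ * y ∈ H) : IndexLE H (Nat.card α) := by
  have hinj : Function.Injective fun q : G ⧸ H => c q.out := by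
    intro p q hpq
    have := h _ _ hpq
    rw [← QuotientGroup.eq] at this
    simpa using this
  have : Finite (G ⧸ H) := Finite.of_injective _ hinj
  exact ⟨index_ne_zero_of_finite, Nat.card_le_card_of_injective _ hinj⟩

theorem IndexLE.exists_inv_mul_mem {H : Subgroup G} {c : ℕ} (h : IndexLE H c)
    (f : Fin (c + 1) → G) : ∃ i j, i ≠ j ∧ (f i)⁻¹ * f j ∈ H := by
  have := h.finiteIndex
  have := Fintype.ofFinite (G ⧸ H)
  obtain ⟨i, j, hij, he⟩ := Fintype.exists_ne_map_eq_of_card_lt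
    (fun i => (QuotientGroup.mk (f i) : G ⧸ H)) (by
      rw [← Nat.card_eq_fintype_card, Fintype.card_fin]
      exact Nat.lt_succ_of_le h.2)
  exact ⟨i, j, hij, QuotientGroup.eq.1 he⟩

theorem exists_inv_mul_notMem_of_not_indexLE {H : Subgroup G} {c : ℕ} (h : ¬ IndexLE H c) :
    ∃ f : Fin (c + 1) → G, ∀ i j, i ≠ j → (f i)⁻¹ * f j ∉ H := by
  obtain ⟨f⟩ : Nonempty (Fin (c + 1) ↪ G ⧸ H) := by
    by_cases h0 : Finite (G ⧸ H)
    · have := Fintype.ofFinite (G ⧸ H)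
      apply Function.Embedding.nonempty_of_card_le
      rw [Fintype.card_fin, ← Nat.card_eq_fintype_card]
      by_contra hlt
      exact h ⟨index_ne_zero_of_finite, Nat.lt_succ_iff.1 (not_le.1 hlt)⟩
    · rw [not_finite_iff_infinite] at h0
      exact ⟨(Fin.valEmbedding).trans (Infinite.natEmbedding _)⟩
  refine ⟨fun i => (f i).out, fun i j hij hmem => hij (f.injective ?_)⟩
  rw [← QuotientGroup.eq] at hmem
  simpa using hmem

end IndexBounds

/-! ### Elements with few conjugates. -/

section SmallClasses

variable {G : Type*} [Group G]

theorem conjugatesOf_eq_range (x : G) : conjugatesOf x = Set.range fun g : G => g * x * g⁻¹ := by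
  ext y
  simp [conjugatesOf, isConj_iff]

theorem encard_conjugatesOf (x : G) :
    (conjugatesOf x).encard = ENat.card (G ⧸ centralizer {x}) := by
  rw [Set.encard]
  let f : G ⧸ centralizer {x} → conjugatesOf x := Quotient.lift
    (fun g => ⟨g * x * g⁻¹, isConj_iff.2 ⟨g, rfl⟩⟩) (by
      intro a b hab
      have hab' : a⁻¹ * b ∈ centralizer {x} := QuotientGroup.leftRel_apply.1 hab
      rw [mem_centralizer_singleton_iff] at hab'
      apply Subtype.ext
      have : a * (a⁻¹ * b * x) * b⁻¹ = a * (x * (a⁻¹ * b)) * b⁻¹ := by rw [hab']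
      simpa [mul_assoc] using this.symm)
  refine (ENat.card_congr (Equiv.ofBijective f ⟨?_, ?_⟩)).symm
  · intro p q
    refine Quotient.inductionOn₂ p q fun a b hab => ?_
    have h : a * x * a⁻¹ = b * x * b⁻¹ := congrArg Subtype.val hab
    refine Quotient.sound (QuotientGroup.leftRel_apply.2 ?_)
    rw [mem_centralizer_singleton_iff]
    have : a⁻¹ * (a * x * a⁻¹) * b = a⁻¹ * (b * x * b⁻¹) * b := by rw [h]
    simpa [mul_assoc] using this.symm
  · rintro ⟨y, hy⟩
    obtain ⟨g, rfl⟩ := isConj_iff.1 hy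
    exact ⟨QuotientGroup.mk g, rfl⟩

theorem mem_smallClassSet_iff {x : G} {n : ℕ} :
    x ∈ smallClassSet G n ↔ IndexLE (centralizer {x}) n := by
  change (conjugatesOf x).encard ≤ n ↔ _
  rw [encard_conjugatesOf]
  constructor
  · intro h
    have hfin : Finite (G ⧸ centralizer {x}) := by
      rw [← ENat.card_lt_top]
      exact h.trans_lt (ENat.natCast_lt_top n)
    rw [ENat.card_eq_coe_natCard] at h
    exact ⟨index_ne_zero_of_finite, by exact_mod_cast h⟩
  · intro h
    have := h.finiteIndex
    rw [ENat.card_eq_coe_natCard]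
    exact_mod_cast h.2

theorem finite_conjugatesOf {x : G} {n : ℕ} (h : x ∈ smallClassSet G n) :
    (conjugatesOf x).Finite :=
  Set.encard_lt_top_iff.1 (lt_of_le_of_lt (show (conjugatesOf x).encard ≤ n from h)
    (ENat.natCast_lt_top n))

theorem ncard_conjugatesOf_le {x : G} {n : ℕ} (h : x ∈ smallClassSet G n) :
    (conjugatesOf x).ncard ≤ n := by
  have h' : (conjugatesOf x).encard ≤ n := h
  rw [← (finite_conjugatesOf h).cast_ncard_eq] at h'
  exact_mod_cast h'

theorem mem_smallClassSet_of_subset {x : G} {s : Set G} (hs : s.Finite) {n : ℕ}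
    (hn : s.ncard ≤ n) (h : ∀ g : G, g * x * g⁻¹ ∈ s) : x ∈ smallClassSet G n := by
  have hsub : conjugatesOf x ⊆ s := by
    rw [conjugatesOf_eq_range]
    rintro _ ⟨g, rfl⟩
    exact h g
  refine (Set.encard_le_encard hsub).trans ?_
  rw [← hs.cast_ncard_eq]
  exact_mod_cast hn

theorem smallClassSet_mono {m n : ℕ} (h : m ≤ n) : smallClassSet G m ⊆ smallClassSet G n :=
  fun _ hx => mem_smallClassSet_iff.2 ((mem_smallClassSet_iff.1 hx).mono h)

theorem one_mem_smallClassSet {n : ℕ} (hn : 0 < n) : (1 : G) ∈ smallClassSet G n :=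
  mem_smallClassSet_of_subset (Set.finite_singleton 1) (by simpa using Nat.succ_le_of_lt hn) (by simp)

theorem mul_mem_smallClassSet {x y : G} {m n : ℕ} (hx : x ∈ smallClassSet G m)
    (hy : y ∈ smallClassSet G n) : x * y ∈ smallClassSet G (m * n) := by
  rw [mem_smallClassSet_iff] at *
  refine (hx.inf hy).of_le fun g hg => ?_
  rw [mem_inf, mem_centralizer_singleton_iff, mem_centralizer_singleton_iff] at hg
  rw [mem_centralizer_singleton_iff, ← mul_assoc, hg.1, mul_assoc, hg.2, mul_assoc]

theorem inv_mem_smallClassSet {x : G} {n : ℕ} (hx : x ∈ smallClassSet G n) :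
    x⁻¹ ∈ smallClassSet G n := by
  rw [mem_smallClassSet_iff] at *
  refine hx.of_le fun g hg => ?_
  rw [mem_centralizer_singleton_iff] at *
  exact (show Commute g x from hg).inv_right

theorem smallClassSet_map {H : Type*} [Group H] (φ : G ≃* H) {x : G} {n : ℕ}
    (hx : x ∈ smallClassSet G n) : φ x ∈ smallClassSet H n := by
  refine mem_smallClassSet_of_subset (s := φ '' conjugatesOf x) ((finite_conjugatesOf hx).image _)
    ((Set.ncard_image_le (finite_conjugatesOf hx)).trans (ncard_conjugatesOf_le hx)) fun g => ?_
  exact ⟨φ.symm g * x * (φ.symm g)⁻¹, isConj_iff.2 ⟨_, rfl⟩, by simp⟩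

theorem conj_mem_smallClassSet {x : G} {n : ℕ} (hx : x ∈ smallClassSet G n) (g : G) :
    g * x * g⁻¹ ∈ smallClassSet G n :=
  smallClassSet_map (MulAut.conj g) hx

end SmallClasses

/-! ### Neumann's theorem, and generation in boundedly many steps. -/

section Neumann

variable {G : Type*} [Group G]

theorem exists_forall_le_of_bounded {ι : Type*} [Nonempty ι] (f : ι → ℕ) {N : ℕ}
    (h : ∀ i, f i ≤ N) : ∃ i, ∀ j, f j ≤ f i := by
  have hb : BddAbove (Set.range f) := ⟨N, by rintro _ ⟨i, rfl⟩; exact h i⟩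
  obtain ⟨i, hi⟩ := Nat.sSup_mem (Set.range_nonempty f) hb
  exact ⟨i, fun j => hi ▸ le_csSup hb ⟨j, rfl⟩⟩

/-- If multiplication by `w` does not increase the number of `X`-conjugates of `a`, and `w` commutes
with enough conjugators, then the `X`-conjugates of `w * a` are the `w`-translates of those
of `a`. -/
theorem exists_conj_mul_eq_of_ncard_le {X : Set G} {a w : G}
    (hcomm : ∀ c ∈ (fun x : G => x * a * x⁻¹) '' X, ∃ b ∈ X, b * a * b⁻¹ = c ∧ Commute b w)
    (hfin : ((fun x : G => x * (w * a) * x⁻¹) '' X).Finite)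
    (hle : ((fun x : G => x * (w * a) * x⁻¹) '' X).ncard ≤
      ((fun x : G => x * a * x⁻¹) '' X).ncard) {x : G} (hx : x ∈ X) :
    ∃ c ∈ (fun x : G => x * a * x⁻¹) '' X, x * (w * a) * x⁻¹ = w * c := by
  have hsub : w • ((fun x : G => x * a * x⁻¹) '' X) ⊆ (fun x : G => x * (w * a) * x⁻¹) '' X := by
    rintro _ ⟨c, hc, rfl⟩
    obtain ⟨b, hb, rfl, hbw⟩ := hcomm c hc
    refine ⟨b, hb, ?_⟩
    simp only [smul_eq_mul, ← mul_assoc]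
    rw [hbw.eq]
  have heq := Set.eq_of_subset_of_ncard_le hsub (by rwa [Set.ncard_smul_set]) hfin
  have hmem : x * (w * a) * x⁻¹ ∈ w • ((fun x : G => x * a * x⁻¹) '' X) := by
    rw [heq]
    exact ⟨x, hx, rfl⟩
  obtain ⟨c, hc, hcx⟩ := hmem
  exact ⟨c, hc, hcx.symm⟩

theorem commutatorElement_mul_left (x y e : G) :
    ⁅x * y, e⁆ = x * ⁅y, e⁆ * x⁻¹ * ⁅x, e⁆ := by
  simp only [commutatorElement_def]
  group

theorem commutatorElement_mul_right (d x y : G) :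
    ⁅d, x * y⁆ = ⁅d, x⁆ * (x * ⁅d, y⁆ * x⁻¹) := by
  simp only [commutatorElement_def]
  group

/-- A bound for the number of commutators in a group all of whose classes have at most `n`
elements. -/
theorem commutatorSet_finite_of_bounded_classes {n : ℕ} (h : ∀ x : G, x ∈ smallClassSet G n) :
    (commutatorSet G).Finite ∧ (commutatorSet G).ncard ≤ n ^ n * (n * n * n) := by
  classical
  have hn : 0 < n := (mem_smallClassSet_iff.1 (h 1)).pos
  let F : G → Finset G := fun x => (finite_conjugatesOf (h x)).toFinset
  have hF : ∀ x y : G, y ∈ F x ↔ ∃ g : G, g * x * g⁻¹ = y := fun x y => by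
    simp [F, conjugatesOf_eq_range]
  have hFcard : ∀ x, (F x).card ≤ n := fun x => by
    rw [← Set.ncard_eq_toFinset_card _ (finite_conjugatesOf (h x))]
    exact ncard_conjugatesOf_le (h x)
  obtain ⟨a, ha⟩ := exists_forall_le_of_bounded (fun x : G => (conjugatesOf x).ncard)
    fun x => ncard_conjugatesOf_le (h x)
  have hb : ∀ c : F a, ∃ b : G, b * a * b⁻¹ = c := fun c => (hF _ _).1 c.2
  choose b hb using hb
  -- By maximality of the class of `a`, multiplying `a` by an element commuting with all conjugators
  -- `b c` merely translates its class.
  let U : Subgroup G := ⨅ c : F a, centralizer {b c}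
  have hU : IndexLE U (n ^ n) := IndexLE.iInf (fun c => mem_smallClassSet_iff.1 (h (b c))) hn
    (by simpa using hFcard a)
  have himg : ∀ x : G, (fun y : G => y * x * y⁻¹) '' Set.univ = conjugatesOf x := fun x => by
    rw [conjugatesOf_eq_range, Set.image_univ]
  have hkey : ∀ u ∈ U, ∀ g : G, ∃ c ∈ F a, ∃ c' ∈ F a, ⁅u, g⁆ = c * c'⁻¹ := by
    intro u hu g
    have hu' : u⁻¹ ∈ U := inv_mem hu
    obtain ⟨c, hc, hcg⟩ := exists_conj_mul_eq_of_ncard_le (X := Set.univ) (a := a) (w := u⁻¹)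
      (by
        intro c hc
        have hc' : c ∈ F a := by
          obtain ⟨g, -, hg⟩ := hc
          exact (hF _ _).2 ⟨g, hg⟩
        refine ⟨b ⟨c, hc'⟩, Set.mem_univ _, hb _, ?_⟩
        have := mem_iInf.1 hu' ⟨c, hc'⟩
        rw [mem_centralizer_singleton_iff] at this
        exact this.symm)
      (by rw [himg]; exact finite_conjugatesOf (h _))
      (by rw [himg, himg]; exact ha _) (Set.mem_univ g)
    refine ⟨c, ?_, g * a * g⁻¹, (hF _ _).2 ⟨g, rfl⟩, ?_⟩
    · obtain ⟨g, -, hg⟩ := hc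
      exact (hF _ _).2 ⟨g, hg⟩
    · have : c = u * (g * (u⁻¹ * a) * g⁻¹) := by rw [hcg]; group
      rw [this, commutatorElement_def]
      group
  have := hU.finiteIndex
  have := Fintype.ofFinite (G ⧸ U)
  -- Writing x = t * u⁻¹ with t a coset representative of `U`, [x, g] is a product of a t-conjugate
  -- of [u⁻¹, g] and [t, g]. The first factor has n * n candidates and the second n, for each of at
  -- most n ^ n cosets.
  let W : Finset G := Finset.univ.biUnion fun q : G ⧸ U =>
    (F a * (F a)⁻¹) * (({q.out} : Finset G) * F (q.out⁻¹))
  have hsub : commutatorSet G ⊆ W := by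
    rintro _ ⟨x, g, rfl⟩
    obtain ⟨u, hu⟩ := QuotientGroup.mk_out_eq_mul U x
    set t : G := (QuotientGroup.mk x : G ⧸ U).out with ht
    have hx : x = t * (u : G)⁻¹ := by rw [hu]; group
    obtain ⟨c, hc, c', hc', hcc⟩ := hkey _ (inv_mem u.2) g
    simp only [W, Finset.coe_biUnion, Set.mem_iUnion, Finset.mem_coe]
    refine ⟨QuotientGroup.mk x, Finset.mem_univ _, ?_⟩
    rw [← ht]
    rw [show ⁅x, g⁆ = ((t * c * t⁻¹) * (t * c' * t⁻¹)⁻¹) * (t * (g * t⁻¹ * g⁻¹)) by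
      nth_rw 1 [hx]
      rw [commutatorElement_mul_left, hcc, commutatorElement_def]
      group]
    have hconj : ∀ z ∈ F a, t * z * t⁻¹ ∈ F a := by
      intro z hz
      obtain ⟨g, rfl⟩ := (hF _ _).1 hz
      exact (hF _ _).2 ⟨t * g, by group⟩
    exact Finset.mul_mem_mul (Finset.mul_mem_mul (hconj _ hc) (Finset.inv_mem_inv (hconj _ hc')))
      (Finset.mul_mem_mul (Finset.mem_singleton_self t) ((hF _ _).2 ⟨g, rfl⟩))
  have hW : W.card ≤ n ^ n * (n * n * n) := by
    refine (Finset.card_biUnion_le_card_mul _ _ (n * n * n) fun q _ => ?_).trans ?_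
    · refine Finset.card_mul_le.trans (Nat.mul_le_mul (Finset.card_mul_le.trans ?_)
        (Finset.card_mul_le.trans ?_))
      · rw [Finset.card_inv]
        exact Nat.mul_le_mul (hFcard a) (hFcard a)
      · rw [Finset.card_singleton, one_mul]
        exact hFcard _
    · refine Nat.mul_le_mul_right _ ?_
      rw [Finset.card_univ, ← Nat.card_eq_fintype_card]
      exact hU.2
  refine ⟨W.finite_toSet.subset hsub, (Set.ncard_le_ncard hsub W.finite_toSet).trans ?_⟩
  rwa [Set.ncard_coe_finset]

/-- The bound for the order of the commutator subgroup of a group all of whose classes have at most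
`n` elements. -/
def boundedClassesBound (n : ℕ) : ℕ :=
  ∑ i ∈ Finset.range (n ^ n * (n * n * n) + 1), cardCommutatorBound i

/-- Neumann's theorem on groups with boundedly finite conjugacy classes. -/
theorem finite_commutator_of_bounded_classes {n : ℕ} (h : ∀ x : G, x ∈ smallClassSet G n) :
    Finite (commutator G) ∧ Nat.card (commutator G) ≤ boundedClassesBound n := by
  obtain ⟨hfin, hcard⟩ := commutatorSet_finite_of_bounded_classes h
  have : Finite (commutatorSet G) := hfin
  refine ⟨inferInstance, (card_commutator_le_of_finite_commutatorSet G).trans ?_⟩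
  -- Summing over all possible numbers of commutators avoids any monotonicity of
  -- `cardCommutatorBound`.
  refine Finset.single_le_sum (f := cardCommutatorBound) (fun _ _ => Nat.zero_le _) ?_
  rw [Finset.mem_range]
  exact Nat.lt_succ_of_le hcard

theorem finite_commutator_subgroup_of_bounded_classes {n : ℕ} {H : Subgroup G}
    (h : ∀ x ∈ H, IndexLE ((centralizer {x}).subgroupOf H) n) :
    Finite (⁅H, H⁆ : Subgroup G) ∧ Nat.card (⁅H, H⁆ : Subgroup G) ≤ boundedClassesBound n := by
  have hH : ∀ x : H, x ∈ smallClassSet H n := by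
    intro x
    rw [mem_smallClassSet_iff]
    refine (h x x.2).of_le fun y hy => ?_
    rw [mem_subgroupOf, mem_centralizer_singleton_iff] at hy
    rw [mem_centralizer_singleton_iff]
    exact Subtype.ext hy
  obtain ⟨hfin, hcard⟩ := finite_commutator_of_bounded_classes hH
  rw [← map_subtype_commutator H]
  let e := (commutator H).equivMapOfInjective H.subtype H.subtype_injective
  exact ⟨Finite.of_equiv _ e.toEquiv, (Nat.card_congr e.toEquiv) ▸ hcard⟩

/-- The normal closure of boundedly many elements with small classes has small commutator
subgroup. -/
theorem finite_commutator_normalClosure {n s : ℕ} {A : Set G} (hA : A.Finite) (hs : A.ncard ≤ s)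
    (h : A ⊆ smallClassSet G n) :
    Finite (⁅normalClosure A, normalClosure A⁆ : Subgroup G) ∧
      Nat.card (⁅normalClosure A, normalClosure A⁆ : Subgroup G) ≤
        boundedClassesBound (n.factorial ^ s) := by
  have : Finite A := hA
  -- Cores make this intersection normal. Its centralizer is then normal and contains `A`, hence
  -- contains the normal closure.
  have hZ : IndexLE (⨅ a : A, (centralizer {(a : G)}).normalCore) (n.factorial ^ s) :=
    IndexLE.iInf (fun a => (mem_smallClassSet_iff.1 (h a.2)).normalCore) (Nat.factorial_pos n) hs
  refine finite_commutator_subgroup_of_bounded_classes fun x hx => ?_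
  refine IndexLE.subgroupOf (hZ.of_le fun z hz => ?_) _
  have hle : normalClosure A ≤ centralizer
      ((⨅ a : A, (centralizer {(a : G)}).normalCore : Subgroup G) : Set G) := by
    have hn : (⨅ a : A, (centralizer {(a : G)}).normalCore).Normal :=
      normal_iInf_normal fun _ => inferInstance
    refine normalClosure_le_normal fun a ha => ?_
    refine mem_centralizer_iff.2 fun y hy => ?_
    exact mem_centralizer_singleton_iff.1 (normalCore_le _ (mem_iInf.1 hy ⟨a, ha⟩))
  exact mem_centralizer_singleton_iff.2 (mem_centralizer_iff.1 (hle hx) z hz)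

/-- A graded family of sets such that few translates of the first one cover the group exhausts the
subgroup generated by it after boundedly many steps. -/
theorem closure_subset_of_coloring {α : Type*} [Finite α] (E : ℕ → Set G) (hE : Monotone E)
    (h1 : (1 : G) ∈ E 0) (hinv : ∀ x ∈ E 1, x⁻¹ ∈ E 1)
    (hmul : ∀ j, ∀ x ∈ E j, ∀ y ∈ E 1, x * y ∈ E (j + 1))
    (c : G → α) (hc : ∀ x y, c x = c y → x⁻¹ * y ∈ E 1) :
    (closure (E 1) : Set G) ⊆ E (2 * Nat.card α) := by
  -- The number of colours on `E (2 * i)` cannot grow more than `Nat.card α` times. Once it stalls,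
  -- x ∈ `E (2 * i + 2)` shares its colour with some y ∈ `E (2 * i)`, so x = y * (y⁻¹ * x) already
  -- lies in `E (2 * i + 1)`.
  have hstab : ∃ i < Nat.card α, c '' E (2 * i) = c '' E (2 * i + 2) := by
    by_contra! hne
    have hcard : ∀ i ≤ Nat.card α, i + 1 ≤ (c '' E (2 * i)).ncard := by
      intro i
      induction i with
      | zero =>
        intro _
        exact Nat.succ_le_of_lt ((Set.ncard_pos (Set.toFinite _)).2 ⟨c 1, 1, h1, rfl⟩)
      | succ i ih =>
        intro hi
        refine Nat.succ_le_of_lt ((ih (by lia)).trans_lt ?_)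
        exact Set.ncard_lt_ncard
          ((Set.image_mono (hE (by lia))).ssubset_of_ne (hne i (by lia))) (Set.toFinite _)
    have := hcard _ le_rfl
    have h2 : (c '' E (2 * Nat.card α)).ncard ≤ Nat.card α := by
      rw [← Set.ncard_univ]
      exact Set.ncard_le_ncard (Set.subset_univ _) (Set.toFinite _)
    lia
  obtain ⟨i, hi, hstab⟩ := hstab
  have hcl : ∀ x ∈ E (2 * i + 2), x ∈ E (2 * i + 1) := by
    intro x hx
    obtain ⟨y, hy, hxy⟩ : c x ∈ c '' E (2 * i) := hstab ▸ ⟨x, hx, rfl⟩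
    simpa using hmul _ y hy _ (hc y x hxy)
  refine Set.Subset.trans (fun x hx => ?_) (hE (by lia : 2 * i + 1 ≤ 2 * Nat.card α))
  induction hx using closure_induction_right with
  | one => exact hE (Nat.zero_le _) h1
  | mul_right x _ y hy ih => exact hcl _ (hmul _ x ih y hy)
  | mul_inv_cancel x _ y hy ih => exact hcl _ (hmul _ x ih _ (hinv y hy))

end Neumann

/-! ### Centralizers modulo a normal subgroup. -/

section CentralizersModulo

variable {G : Type*} [Group G]

/-- The subgroup of all elements commuting with `X` modulo the normal subgroup `K`. -/
def centralizerMod (K : Subgroup G) [K.Normal] (X : Set G) : Subgroup G :=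
  (centralizer (QuotientGroup.mk' K '' X)).comap (QuotientGroup.mk' K)

theorem mem_centralizerMod {K : Subgroup G} [K.Normal] {X : Set G} {g : G} :
    g ∈ centralizerMod K X ↔ ∀ x ∈ X, ⁅g, x⁆ ∈ K := by
  simp only [centralizerMod, mem_comap, mem_centralizer_iff, Set.forall_mem_image]
  refine forall₂_congr fun x _ => ?_
  rw [← (QuotientGroup.eq_one_iff ⁅g, x⁆), commutatorElement_def]
  simp only [QuotientGroup.mk'_apply, QuotientGroup.mk_mul, QuotientGroup.mk_inv]
  rw [mul_inv_eq_one, mul_inv_eq_iff_eq_mul, eq_comm]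

theorem mem_centralizerMod_singleton {K : Subgroup G} [K.Normal] {g x : G} :
    g ∈ centralizerMod K {x} ↔ ⁅g, x⁆ ∈ K := by
  simp [mem_centralizerMod]

theorem centralizerMod_mono {K L : Subgroup G} [K.Normal] [L.Normal] (h : K ≤ L) (X : Set G) :
    centralizerMod K X ≤ centralizerMod L X := fun _ hg =>
  mem_centralizerMod.2 fun x hx => h (mem_centralizerMod.1 hg x hx)

theorem centralizerMod_closure (K : Subgroup G) [K.Normal] (X : Set G) :
    centralizerMod K (closure X : Set G) = centralizerMod K X := by
  rw [centralizerMod, centralizerMod, ← coe_map, MonoidHom.map_closure, centralizer_closure]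

theorem centralizerMod_singleton_inf_le_mul (K : Subgroup G) [K.Normal] (x y : G) :
    centralizerMod K {x} ⊓ centralizerMod K {y} ≤ centralizerMod K {x * y} := by
  intro d hd
  rw [mem_inf, mem_centralizerMod_singleton, mem_centralizerMod_singleton] at hd
  rw [mem_centralizerMod_singleton, commutatorElement_mul_right]
  exact mul_mem hd.1 (Normal.conj_mem inferInstance _ hd.2 _)

theorem centralizerMod_singleton_inv (K : Subgroup G) [K.Normal] (x : G) :
    centralizerMod K {x⁻¹} = centralizerMod K {x} := by
  have key : ∀ x : G, centralizerMod K {x} ≤ centralizerMod K {x⁻¹} := by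
    intro x d hd
    rw [mem_centralizerMod_singleton] at *
    have : ⁅d, x⁻¹⁆ = x⁻¹ * ⁅d, x⁆⁻¹ * x⁻¹⁻¹ := by
      simp only [commutatorElement_def]
      group
    rw [this]
    exact Normal.conj_mem inferInstance _ (inv_mem hd) _
  exact le_antisymm (by simpa using key x⁻¹) (key x)

instance normal_centralizerMod_smallClassSet (K : Subgroup G) [K.Normal] (N : ℕ) :
    (centralizerMod K (smallClassSet G N)).Normal where
  conj_mem a ha g := by
    rw [mem_centralizerMod] at *
    intro x hx
    have h := ha (g⁻¹ * x * g⁻¹⁻¹) (conj_mem_smallClassSet hx _)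
    have : ⁅g * a * g⁻¹, x⁆ = g * ⁅a, g⁻¹ * x * g⁻¹⁻¹⁆ * g⁻¹ := by
      simp only [commutatorElement_def]
      group
    rw [this]
    exact Normal.conj_mem inferInstance _ h _

instance normal_closure_smallClassSet (N : ℕ) : (closure (smallClassSet G N)).Normal := by
  have : Group.conjugatesOfSet (smallClassSet G N) ⊆ smallClassSet G N := by
    intro y hy
    obtain ⟨a, ha, hay⟩ := Group.mem_conjugatesOfSet_iff.1 hy
    obtain ⟨g, rfl⟩ := isConj_iff.1 hay
    exact conj_mem_smallClassSet ha g
  have h : closure (smallClassSet G N) = normalClosure (smallClassSet G N) :=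
    le_antisymm closure_le_normalClosure (closure_mono this)
  rw [h]
  infer_instance

/-- A subgroup of index at most `r` commutes with `e` modulo the
centralizer of `B_N(G)` modulo a normal subgroup of order at most `q`. -/
def AlmostCentral (N r q : ℕ) (e : G) : Prop :=
  ∃ (Q : Subgroup G) (_ : Q.Normal), Finite Q ∧ Nat.card Q ≤ q ∧
    IndexLE (centralizerMod (centralizerMod Q (smallClassSet G N)) {e}) r

end CentralizersModulo

/-! ### From the covering condition to almost central elements. -/

section Covering

variable {G : Type*} [Group G]

/-- Colour g by an s ∈ S with [g, e] ∈ s B_n. For x, y of equal colour the factor s cancels up to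
conjugation, so [x⁻¹ * y, e] has at most n * n conjugates; `closure_subset_of_coloring` then bounds
the classes on the whole generated subgroup. -/
theorem CoveringCondition.exists_subgroup {k n : ℕ} (hn : 0 < n) (h : CoveringCondition G k n)
    (e : G) : ∃ D : Subgroup G, IndexLE D k ∧
      ∀ d ∈ D, ⁅d, e⁆ ∈ smallClassSet G ((n * n) ^ (2 * k)) := by
  obtain ⟨S, hS, hcov⟩ := h
  have hSfin : S.Finite := Set.encard_lt_top_iff.1 (hS.trans_lt (ENat.natCast_lt_top k))
  have : Finite S := hSfin
  have hScard : Nat.card S ≤ k := by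
    rw [← hSfin.cast_ncard_eq] at hS
    exact_mod_cast hS
  have hex : ∀ g : G, ∃ s : S, ∃ b ∈ smallClassSet G n, ⁅g, e⁆ = s * b := by
    intro g
    obtain ⟨s, hs, b, hb, hsb⟩ := hcov (commutator_mem_commutatorSet g e)
    exact ⟨⟨s, hs⟩, b, hb, hsb.symm⟩
  choose c b hb hcb using hex
  have hnn : 0 < n * n := Nat.mul_pos hn hn
  let E : ℕ → Set G := fun j => {g | ⁅g, e⁆ ∈ smallClassSet G ((n * n) ^ j)}
  have hE : Monotone E := fun i j hij g hg =>
    smallClassSet_mono (Nat.pow_le_pow_right hnn hij) hg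
  have hone : (1 : G) ∈ E 0 := by
    simpa [E] using one_mem_smallClassSet (G := G) one_pos
  have hinv : ∀ x ∈ E 1, x⁻¹ ∈ E 1 := by
    intro x hx
    have : ⁅x⁻¹, e⁆ = x⁻¹ * ⁅x, e⁆⁻¹ * x⁻¹⁻¹ := by
      simp only [commutatorElement_def]
      group
    change ⁅x⁻¹, e⁆ ∈ smallClassSet G ((n * n) ^ 1)
    rw [this]
    exact conj_mem_smallClassSet (inv_mem_smallClassSet hx) _
  have hmul : ∀ j, ∀ x ∈ E j, ∀ y ∈ E 1, x * y ∈ E (j + 1) := by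
    intro j x hx y hy
    change ⁅x * y, e⁆ ∈ smallClassSet G ((n * n) ^ (j + 1))
    rw [commutatorElement_mul_left, add_comm, pow_add]
    exact mul_mem_smallClassSet (conj_mem_smallClassSet hy _) hx
  have hc : ∀ x y, c x = c y → x⁻¹ * y ∈ E 1 := by
    intro x y hxy
    have h1 : ⁅x⁻¹ * y, e⁆ = x⁻¹ * (c x * (b y * (b x)⁻¹) * (c x : G)⁻¹) * x⁻¹⁻¹ := by
      have h2 : ⁅x⁻¹ * y, e⁆ = x⁻¹ * (⁅y, e⁆ * ⁅x, e⁆⁻¹) * x⁻¹⁻¹ := by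
        simp only [commutatorElement_def]
        group
      rw [h2, hcb, hcb, hxy]
      group
    change ⁅x⁻¹ * y, e⁆ ∈ smallClassSet G ((n * n) ^ 1)
    rw [h1, pow_one]
    exact conj_mem_smallClassSet (conj_mem_smallClassSet
      (mul_mem_smallClassSet (hb y) (inv_mem_smallClassSet (hb x))) _) _
  refine ⟨closure (E 1), (IndexLE.of_coloring c fun x y hxy =>
    subset_closure (hc x y hxy)).mono hScard, fun d hd => ?_⟩
  exact hE (Nat.mul_le_mul_left 2 hScard) (closure_subset_of_coloring E hE hone hinv hmul c hc hd)

/-- Neumann's maximality argument, with conjugation only by elements of B_N and with a = [d₀, e]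
maximal among the [d, e]. The error terms are commutators of a with finitely many conjugators from
B_N, and these generate a small normal subgroup. -/
theorem almostCentral_of_commutator_mem {k N : ℕ} {D : Subgroup G} (hD : IndexLE D k)
    {e : G} (h : ∀ d ∈ D, ⁅d, e⁆ ∈ smallClassSet G N) :
    AlmostCentral N (N.factorial ^ N * k)
      (boundedClassesBound (N.factorial ^ (N + 1))) e := by
  let Y : G → Set G := fun a => (fun x : G => x * a * x⁻¹) '' smallClassSet G N
  have hYsub : ∀ a, Y a ⊆ conjugatesOf a := by
    rintro a _ ⟨x, -, rfl⟩
    exact isConj_iff.2 ⟨x, rfl⟩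
  have hYfin : ∀ d ∈ D, (Y ⁅d, e⁆).Finite := fun d hd =>
    (finite_conjugatesOf (h d hd)).subset (hYsub _)
  have hYcard : ∀ d ∈ D, (Y ⁅d, e⁆).ncard ≤ N := fun d hd =>
    (Set.ncard_le_ncard (hYsub _) (finite_conjugatesOf (h d hd))).trans
      (ncard_conjugatesOf_le (h d hd))
  obtain ⟨⟨d₀, hd₀⟩, hmax⟩ := exists_forall_le_of_bounded (fun d : D => (Y ⁅(d : G), e⁆).ncard)
    fun d => hYcard d d.2
  set a : G := ⁅d₀, e⁆ with ha
  have hYa : Finite (Y a) := hYfin d₀ hd₀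
  have hb : ∀ c : Y a, ∃ b ∈ smallClassSet G N, b * a * b⁻¹ = c := fun c => c.2
  choose b hbN hbc using hb
  let A : Set G := insert a (Set.range b)
  have hAfin : A.Finite := (Set.finite_range b).insert a
  have hAcard : A.ncard ≤ N + 1 := by
    refine (Set.ncard_insert_le _ _).trans (Nat.succ_le_succ ?_)
    rw [← Set.image_univ]
    refine (Set.ncard_image_le (Set.toFinite _)).trans ?_
    rw [Set.ncard_univ]
    exact hYcard d₀ hd₀
  have hAN : A ⊆ smallClassSet G N := by
    rintro x (rfl | ⟨c, rfl⟩)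
    · exact h d₀ hd₀
    · exact hbN c
  obtain ⟨hQfin, hQcard⟩ := finite_commutator_normalClosure hAfin hAcard hAN
  set Q : Subgroup G := ⁅normalClosure A, normalClosure A⁆ with hQ
  have hQn : Q.Normal := inferInstance
  refine ⟨Q, hQn, hQfin, hQcard, ?_⟩
  -- Cores make `U` normal, so that u ∈ `U` gives [u, e] ∈ `U`.
  let U : Subgroup G := ⨅ c : Y a, (centralizer {b c}).normalCore
  have hU : IndexLE U (N.factorial ^ N) := IndexLE.iInf
    (fun c => (mem_smallClassSet_iff.1 (hbN c)).normalCore) (Nat.factorial_pos N) (hYcard d₀ hd₀)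
  have hUn : U.Normal := normal_iInf_normal fun _ => inferInstance
  refine (hU.inf hD).of_le ?_
  rintro u ⟨huU, huD⟩
  rw [mem_centralizerMod_singleton]
  have hue : ⁅u, e⁆ ∈ U := by
    rw [commutatorElement_def, mul_assoc, mul_assoc, ← mul_assoc e]
    exact mul_mem huU (hUn.conj_mem _ (inv_mem huU) e)
  set w : G := d₀ * ⁅u, e⁆ * d₀⁻¹ with hw
  have hwU : w ∈ U := hUn.conj_mem _ hue d₀
  have hwa : ⁅d₀ * u, e⁆ = w * a := by rw [commutatorElement_mul_left]
  -- The element `w` is conjugate to [u, e], and the centralizer in question is normal.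
  suffices hwC : w⁻¹ ∈ centralizerMod Q (smallClassSet G N) by
    have h1 := Normal.conj_mem inferInstance _ (inv_mem hwC) d₀⁻¹
    rwa [hw, inv_inv, show d₀⁻¹ * (d₀ * ⁅u, e⁆ * d₀⁻¹) * d₀⁻¹⁻¹ = ⁅u, e⁆ by group] at h1
  rw [mem_centralizerMod]
  intro x hx
  have hdu : d₀ * u ∈ D := mul_mem hd₀ huD
  obtain ⟨c, hc, hxc⟩ := exists_conj_mul_eq_of_ncard_le (X := smallClassSet G N) (a := a) (w := w)
    (by
      intro c hc
      refine ⟨b ⟨c, hc⟩, hbN _, hbc _, ?_⟩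
      have := normalCore_le _ (mem_iInf.1 hwU ⟨c, hc⟩)
      rw [mem_centralizer_singleton_iff] at this
      exact this.symm)
    (hwa ▸ hYfin _ hdu) (hwa ▸ hmax ⟨_, hdu⟩) hx
  have hcomm : ⁅w⁻¹, x⁆ = c * (x * a * x⁻¹)⁻¹ := by
    rw [show c = w⁻¹ * (x * (w * a) * x⁻¹) by rw [hxc]; group, commutatorElement_def]
    group
  have hYQ : ∀ c ∈ Y a, c * a⁻¹ ∈ Q := by
    intro c hc
    rw [show c = b ⟨c, hc⟩ * a * (b ⟨c, hc⟩)⁻¹ from (hbc ⟨c, hc⟩).symm]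
    exact commutator_mem_commutator (subset_normalClosure (Or.inr ⟨_, rfl⟩))
      (subset_normalClosure (Or.inl rfl))
  rw [hcomm, show c * (x * a * x⁻¹)⁻¹ = c * a⁻¹ * (x * a * x⁻¹ * a⁻¹)⁻¹ by group]
  exact mul_mem (hYQ c hc) (inv_mem (hYQ _ ⟨x, hx, rfl⟩))

end Covering

/-! ### Making the finite normal subgroup independent of the element. -/

section Uniform

variable {G : Type*} [Group G]

theorem AlmostCentral.mono {N r r' q q' : ℕ} {e : G} (h : AlmostCentral N r q e) (hr : r ≤ r')
    (hq : q ≤ q') : AlmostCentral N r' q' e := by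
  obtain ⟨Q, hQ, hfin, hcard, hidx⟩ := h
  exact ⟨Q, hQ, hfin, hcard.trans hq, hidx.mono hr⟩

theorem card_sup_le_of_normal (H K : Subgroup G) [K.Normal] [Finite H] [Finite K] :
    Finite (H ⊔ K : Subgroup G) ∧
      Nat.card (H ⊔ K : Subgroup G) ≤ Nat.card H * Nat.card K := by
  have hmul : ((H ⊔ K : Subgroup G) : Set G) = (H : Set G) * K := (mul_normal H K)
  have hfin : ((H : Set G) * (K : Set G)).Finite :=
    Set.Finite.mul (Set.toFinite (H : Set G)) (Set.toFinite (K : Set G))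
  refine ⟨?_, ?_⟩
  · change Finite ((H ⊔ K : Subgroup G) : Set G)
    rw [hmul]
    exact hfin
  · change Nat.card ((H ⊔ K : Subgroup G) : Set G) ≤ _
    rw [hmul]
    exact Set.natCard_mul_le

/-- Finitely many elements that are almost central are so with respect to a common subgroup. -/
theorem exists_common_of_almostCentral {N r q : ℕ} (F : Finset G)
    (h : ∀ e ∈ F, AlmostCentral N r q e) :
    ∃ (Q : Subgroup G) (_ : Q.Normal), Finite Q ∧ Nat.card Q ≤ q ^ F.card ∧
      ∀ e ∈ F, IndexLE (centralizerMod (centralizerMod Q (smallClassSet G N)) {e}) r := by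
  classical
  induction F using Finset.induction_on with
  | empty => exact ⟨⊥, inferInstance, inferInstance, by simp, by simp⟩
  | insert t F ht ih =>
    obtain ⟨Q, hQ, hfin, hcard, hidx⟩ := ih fun e he => h e (Finset.mem_insert_of_mem he)
    obtain ⟨R, hR, hRfin, hRcard, hRidx⟩ := h t (Finset.mem_insert_self _ _)
    obtain ⟨h1, h2⟩ := card_sup_le_of_normal Q R
    refine ⟨Q ⊔ R, inferInstance, h1, h2.trans ?_, ?_⟩
    · rw [Finset.card_insert_of_notMem ht, pow_succ]
      exact Nat.mul_le_mul hcard hRcard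
    · intro e he
      rcases Finset.mem_insert.1 he with rfl | he
      · exact hRidx.of_le (centralizerMod_mono (centralizerMod_mono le_sup_right _) _)
      · exact (hidx e he).of_le (centralizerMod_mono (centralizerMod_mono le_sup_left _) _)

/-- The step at which the order of the subgroup can no longer be decreased: one normal subgroup
serves all elements of a subgroup of bounded index. -/
theorem exists_uniform_on_finiteIndex {N r q : ℕ} (hall : ∀ e : G, AlmostCentral N r (q + 1) e)
    {a₁ : G} (ha₁ : ¬ AlmostCentral N (r * r) q a₁) :
    ∃ (Q : Subgroup G) (_ : Q.Normal) (V : Subgroup G), Finite Q ∧ Nat.card Q ≤ q + 1 ∧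
      IndexLE V (N.factorial ^ (2 ^ (q + 1) * ((r * r + 1) * (r * r + 1)))) ∧
      ∀ v ∈ V, IndexLE (centralizerMod (centralizerMod Q (smallClassSet G N)) {v}) (r * r) := by
  classical
  obtain ⟨Q₁, hQ₁, hfin₁, hcard₁, hidx₁⟩ := hall a₁
  have hr : 0 < r := hidx₁.pos
  -- A smaller order would contradict the choice of `a₁`, since r ≤ r * r.
  have hcard₁' : Nat.card Q₁ = q + 1 := by
    by_contra hne
    exact ha₁ (AlmostCentral.mono ⟨Q₁, hQ₁, hfin₁, by lia, hidx₁⟩ (Nat.le_mul_self r) le_rfl)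
  let I : Type _ := {Q : Subgroup G // Q.Normal ∧ Q < Q₁}
  have hIinj : Function.Injective fun Q : I => {x : Q₁ | (x : G) ∈ Q.1} := by
    intro Q R hQR
    apply Subtype.ext
    ext x
    constructor <;> intro hx
    · have : (⟨x, Q.2.2.le hx⟩ : Q₁) ∈ {x : Q₁ | (x : G) ∈ Q.1} := hx
      have hQR' : {x : Q₁ | (x : G) ∈ Q.1} = {x : Q₁ | (x : G) ∈ R.1} := hQR
      rw [hQR'] at this
      exact this
    · have : (⟨x, R.2.2.le hx⟩ : Q₁) ∈ {x : Q₁ | (x : G) ∈ R.1} := hx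
      have hQR' : {x : Q₁ | (x : G) ∈ Q.1} = {x : Q₁ | (x : G) ∈ R.1} := hQR
      rw [← hQR'] at this
      exact this
  have hIfin : Finite I := Finite.of_injective _ hIinj
  have hIcard : Nat.card I ≤ 2 ^ (q + 1) := by
    refine (Nat.card_le_card_of_injective _ hIinj).trans ?_
    have := Fintype.ofFinite Q₁
    rw [Nat.card_eq_fintype_card, Fintype.card_set, ← Nat.card_eq_fintype_card, hcard₁']
  -- For each smaller normal subgroup the failure at `a₁` is witnessed by finitely many elements of
  -- B_N. The subgroup `V` will centralize all these witnesses.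
  have hsep : ∀ Q : I, ∃ f : Fin (r * r + 1) → G, ∀ i j, i ≠ j →
      ∃ x ∈ smallClassSet G N, ⁅⁅(f i)⁻¹ * f j, a₁⁆, x⁆ ∉ Q.1 := by
    intro Q
    have hQn : Q.1.Normal := Q.2.1
    have hQfin : Finite Q.1 := Finite.Set.subset (Q₁ : Set G) Q.2.2.le
    have hQcard : Nat.card Q.1 ≤ q := by
      have : Nat.card Q.1 < Nat.card Q₁ :=
        Set.ncard_lt_ncard (s := (Q.1 : Set G)) (t := (Q₁ : Set G)) Q.2.2 (Set.toFinite _)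
      lia
    obtain ⟨f, hf⟩ := exists_inv_mul_notMem_of_not_indexLE
      (H := centralizerMod (centralizerMod Q.1 (smallClassSet G N)) {a₁}) (c := r * r)
      fun hidx => ha₁ ⟨Q.1, hQn, hQfin, hQcard, hidx⟩
    refine ⟨f, fun i j hij => ?_⟩
    have := hf i j hij
    rw [mem_centralizerMod_singleton, mem_centralizerMod] at this
    push Not at this
    exact this
  choose f hf using hsep
  choose x hxN hx using hf
  let X : I × Fin (r * r + 1) × Fin (r * r + 1) → Subgroup G := fun p =>
    if hp : p.2.1 ≠ p.2.2 then (centralizer {x p.1 p.2.1 p.2.2 hp}).normalCore else ⊤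
  have hX : ∀ p, IndexLE (X p) N.factorial := by
    intro p
    by_cases hp : p.2.1 ≠ p.2.2
    · simp only [X, dif_pos hp]
      exact (mem_smallClassSet_iff.1 (hxN _ _ _ hp)).normalCore
    · simp only [X, dif_neg hp]
      exact ⟨by simp, by simpa using Nat.succ_le_of_lt (Nat.factorial_pos N)⟩
  have hXn : ∀ p, (X p).Normal := by
    intro p
    by_cases hp : p.2.1 ≠ p.2.2
    · simp only [X, dif_pos hp]
      infer_instance
    · simp only [X, dif_neg hp]
      infer_instance
  have hVn : (⨅ p, X p).Normal := normal_iInf_normal hXn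
  refine ⟨Q₁, hQ₁, ⨅ p, X p, hfin₁, hcard₁, IndexLE.iInf hX (Nat.factorial_pos N) ?_, ?_⟩
  · rw [Nat.card_prod, Nat.card_prod, Nat.card_fin]
    exact Nat.mul_le_mul_right _ hIcard
  intro v hv
  obtain ⟨Q, hQ, hfin, hcard, hidx⟩ := hall (a₁ * v)
  have hle : Q₁ ≤ Q := by
    by_contra hnle
    -- If `Q` misses part of `Q₁`, pigeonhole gives a quotient d of two elements of `f P` that works
    -- for both `a₁ * v` modulo `Q` and `a₁` modulo `Q₁`. As `V` centralizes the witness `y`, the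
    -- commutator [[d, a₁], y] equals [[d, a₁ * v], y], hence lies in `Q ⊓ Q₁`, contrary to the
    -- choice of `y`.
    let P : I := ⟨Q ⊓ Q₁, inferInstance, lt_of_le_of_ne inf_le_right fun h =>
      hnle (h ▸ inf_le_left)⟩
    obtain ⟨i, j, hij, hmem⟩ := (hidx.inf hidx₁).exists_inv_mul_mem (f P)
    refine hx P i j hij ?_
    set d : G := (f P i)⁻¹ * f P j
    set y : G := x P i j hij with hy
    rw [mem_inf, mem_centralizerMod_singleton, mem_centralizerMod_singleton] at hmem
    refine mem_inf.2 ⟨?_, mem_centralizerMod.1 hmem.2 y (hxN _ _ _ hij)⟩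
    have hdv : ⁅d, v⁆ ∈ ⨅ p, X p := by
      rw [commutatorElement_def]
      exact mul_mem (hVn.conj_mem _ hv d) (inv_mem hv)
    have hcent := mem_iInf.1 (hVn.conj_mem _ hdv a₁) (P, i, j)
    simp only [X, dif_pos hij] at hcent
    have hcomm : (a₁ * ⁅d, v⁆ * a₁⁻¹) * y = y * (a₁ * ⁅d, v⁆ * a₁⁻¹) :=
      mem_centralizer_singleton_iff.1 (normalCore_le _ hcent)
    have h1 := mem_centralizerMod.1 hmem.1 y (hxN _ _ _ hij)
    rw [commutatorElement_mul_right, commutatorElement_mul_left,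
      commutatorElement_eq_one_iff_mul_comm.2 hcomm, mul_one, mul_inv_cancel, one_mul] at h1
    exact h1
  have heq : Q₁ = Q := by
    apply SetLike.coe_injective
    refine Set.eq_of_subset_of_ncard_le hle ?_ (Set.toFinite _)
    exact hcard.trans hcard₁'.ge
  subst heq
  have hinf := hidx₁.inf hidx
  -- Now v = a₁⁻¹ * (a₁ * v), with both factors controlled modulo the same subgroup.
  rw [← centralizerMod_singleton_inv _ a₁] at hinf
  refine hinf.of_le ((centralizerMod_singleton_inf_le_mul _ _ _).trans ?_)
  rw [inv_mul_cancel_left]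

/-- Each e is a coset representative times an element of `V`. One subgroup serves the at most c
representatives, and joining it to `Q` serves all e. -/
theorem exists_uniform_of_finiteIndex {N r q c : ℕ} (hall : ∀ e : G, AlmostCentral N r q e)
    {Q V : Subgroup G} [Q.Normal] [Finite Q] (hQ : Nat.card Q ≤ q) (hV : IndexLE V c) {s : ℕ}
    (h : ∀ v ∈ V, IndexLE (centralizerMod (centralizerMod Q (smallClassSet G N)) {v}) s) :
    ∃ (R : Subgroup G) (_ : R.Normal), Finite R ∧ Nat.card R ≤ q ^ (c + 1) ∧
      ∀ e : G, IndexLE (centralizerMod (centralizerMod R (smallClassSet G N)) {e}) (r * s) := by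
  classical
  have := hV.finiteIndex
  have := Fintype.ofFinite (G ⧸ V)
  let F : Finset G := Finset.univ.image fun p : G ⧸ V => p.out
  have hF : F.card ≤ c := by
    refine Finset.card_image_le.trans ?_
    rw [Finset.card_univ, ← Nat.card_eq_fintype_card]
    exact hV.2
  have hq : 0 < q := Nat.card_pos.trans_le hQ
  obtain ⟨P, hPn, hPfin, hPcard, hP⟩ := exists_common_of_almostCentral F fun e _ => hall e
  obtain ⟨h1, h2⟩ := card_sup_le_of_normal P Q
  refine ⟨P ⊔ Q, inferInstance, h1, h2.trans ?_, fun e => ?_⟩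
  · rw [pow_succ]
    exact Nat.mul_le_mul (hPcard.trans (Nat.pow_le_pow_right hq hF)) hQ
  · obtain ⟨v, hv⟩ := QuotientGroup.mk_out_eq_mul V e
    set t : G := (QuotientGroup.mk e : G ⧸ V).out with ht
    have he : e = t * (v : G)⁻¹ := by rw [hv]; group
    rw [he]
    have ht' := (hP t (Finset.mem_image.2 ⟨_, Finset.mem_univ _, rfl⟩)).of_le
      (centralizerMod_mono (centralizerMod_mono (le_sup_left : P ≤ P ⊔ Q) _) _)
    have hv' := (h _ (inv_mem v.2)).of_le
      (centralizerMod_mono (centralizerMod_mono (le_sup_right : Q ≤ P ⊔ Q) _) _)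
    exact (ht'.inf hv').of_le (centralizerMod_singleton_inf_le_mul _ _ _)

end Uniform

/-- If every element is almost central then all elements are so with respect to one normal
subgroup of bounded order. -/
theorem exists_uniform_of_almostCentral.{u} (N q r : ℕ) : ∃ C : ℕ, ∀ (G : Type u) [Group G],
    (∀ e : G, AlmostCentral N r q e) →
      ∃ (Q : Subgroup G) (_ : Q.Normal), Finite Q ∧ Nat.card Q ≤ C ∧
        ∀ e : G, IndexLE (centralizerMod (centralizerMod Q (smallClassSet G N)) {e}) C := by
  induction q generalizing r with
  | zero =>
    refine ⟨0, fun G _ h => ?_⟩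
    obtain ⟨Q, _, hfin, hcard, _⟩ := h 1
    exact absurd (Nat.card_pos (α := Q)) (by lia)
  | succ q ih =>
    obtain ⟨C, hC⟩ := ih (r * r)
    let c := N.factorial ^ (2 ^ (q + 1) * ((r * r + 1) * (r * r + 1)))
    refine ⟨C + (q + 1) ^ (c + 1) + r * (r * r), fun G _ h => ?_⟩
    -- Either the order bound drops everywhere, at the cost of squaring r, or an exceptional element
    -- fixes the subgroup on finite index.
    by_cases hdrop : ∀ e : G, AlmostCentral N (r * r) q e
    · obtain ⟨Q, hQ, hfin, hcard, hidx⟩ := hC G hdrop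
      exact ⟨Q, hQ, hfin, by lia, fun e => (hidx e).mono (by lia)⟩
    · push Not at hdrop
      obtain ⟨a₁, ha₁⟩ := hdrop
      obtain ⟨Q, hQ, V, hfin, hcard, hV, hidx⟩ := exists_uniform_on_finiteIndex h ha₁
      obtain ⟨R, hR, hRfin, hRcard, hRidx⟩ := exists_uniform_of_finiteIndex h hcard hV hidx
      exact ⟨R, hR, hRfin, hRcard.trans (by lia), fun e => (hRidx e).mono (by lia)⟩

/-! ### The quotient by K and a first subgroup of G'. -/

theorem CoveringCondition.exists_subgroup_commutator.{u} (k n : ℕ) (hn : 0 < n) :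
    ∃ C : ℕ, ∀ (G : Type u) [Group G], CoveringCondition G k n →
      ∃ B : Subgroup (commutator G), IndexLE B C ∧ Finite (⁅B, B⁆ : Subgroup (commutator G)) ∧
        Nat.card (⁅B, B⁆ : Subgroup (commutator G)) ≤ C := by
  let N := (n * n) ^ (2 * k)
  obtain ⟨C, hC⟩ := exists_uniform_of_almostCentral.{u} N
    (boundedClassesBound (N.factorial ^ (N + 1))) (N.factorial ^ N * k)
  refine ⟨C + boundedClassesBound (C * k), fun G _ hG => ?_⟩
  choose D hDk hD using fun e : G => hG.exists_subgroup hn e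
  obtain ⟨Q, hQ, hQfin, hQcard, hQidx⟩ := hC G fun e =>
    almostCentral_of_commutator_mem (hDk e) (hD e)
  let M : Subgroup G := closure (smallClassSet G N)
  -- The first factor centralizes generators of the second modulo `Q`, whence [K, K] ≤ `Q`; both
  -- factors contain [d, e] for d in a subgroup of bounded index.
  let K : Subgroup G := centralizerMod Q (smallClassSet G N) ⊓ M
  have hK : ∀ y : G ⧸ K, y ∈ smallClassSet (G ⧸ K) (C * k) := by
    intro y
    obtain ⟨e, rfl⟩ := QuotientGroup.mk'_surjective K y
    have hidx : IndexLE (centralizerMod K {e}) (C * k) := by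
      refine ((hQidx e).inf (hDk e)).of_le fun d hd => ?_
      rw [mem_inf, mem_centralizerMod_singleton] at hd
      exact mem_centralizerMod_singleton.2 ⟨hd.1, subset_closure (hD e d hd.2)⟩
    rw [mem_smallClassSet_iff]
    rw [centralizerMod, Set.image_singleton] at hidx
    unfold IndexLE at hidx ⊢
    rwa [index_comap_of_surjective _ (QuotientGroup.mk'_surjective K)] at hidx
  obtain ⟨hfin, hcard⟩ := finite_commutator_of_bounded_classes hK
  have hindex : (K.subgroupOf (commutator G)).index = Nat.card (commutator (G ⧸ K)) := by
    have h1 := relIndex_ker (K := commutator G) (QuotientGroup.mk' K)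
    rw [QuotientGroup.ker_mk'] at h1
    have h2 : (commutator G).map (QuotientGroup.mk' K) = commutator (G ⧸ K) := by
      rw [commutator_def, map_commutator, ← MonoidHom.range_eq_map,
        MonoidHom.range_eq_top.2 (QuotientGroup.mk'_surjective K), commutator_def]
    rw [h2] at h1
    exact h1
  have hcomm : ∀ x ∈ (⁅K.subgroupOf (commutator G), K.subgroupOf (commutator G)⁆ :
      Subgroup (commutator G)), (x : G) ∈ Q := by
    suffices h : (⁅K.subgroupOf (commutator G), K.subgroupOf (commutator G)⁆ :
      Subgroup (commutator G)) ≤ Q.subgroupOf (commutator G) from fun x hx => h hx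
    refine commutator_le.2 fun x hx y hy => ?_
    rw [mem_subgroupOf] at hx hy
    have hxK := hx.1
    rw [SetLike.mem_coe, ← centralizerMod_closure] at hxK
    exact mem_centralizerMod.1 hxK _ hy.2
  refine ⟨K.subgroupOf (commutator G), ⟨?_, ?_⟩, ?_⟩
  · rw [hindex]
    exact Nat.card_pos.ne'
  · rw [hindex]
    exact hcard.trans (Nat.le_add_left _ _)
  · have hinj : Function.Injective fun x : (⁅K.subgroupOf (commutator G),
        K.subgroupOf (commutator G)⁆ : Subgroup (commutator G)) =>
        (⟨(x : commutator G), hcomm x x.2⟩ : Q) := by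
      intro x y hxy
      exact Subtype.ext (Subtype.ext (Subtype.mk.inj hxy))
    exact ⟨Finite.of_injective _ hinj, (Nat.card_le_card_of_injective _ hinj).trans
      (hQcard.trans (Nat.le_add_right _ _))⟩

/-! ### Characteristic replacement and nilpotency. -/

section Characteristic

variable {H : Type*} [Group H]

theorem characteristic_closure_smallClassSet (m : ℕ) :
    (closure (smallClassSet H m)).Characteristic := by
  rw [characteristic_iff_map_le]
  intro φ
  rw [MonoidHom.map_closure]
  refine closure_mono ?_
  rintro _ ⟨x, hx, rfl⟩
  exact smallClassSet_map φ hx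

/-- The B-conjugates of x ∈ B lie in the coset B'x, so there are at most c of them; the index of B
contributes the other factor. -/
theorem subset_smallClassSet_of_commutator {c : ℕ} {B : Subgroup H} (hB : IndexLE B c)
    [Finite (⁅B, B⁆ : Subgroup H)] (hcard : Nat.card (⁅B, B⁆ : Subgroup H) ≤ c) :
    (B : Set H) ⊆ smallClassSet H (c * c) := by
  intro x hx
  rw [mem_smallClassSet_iff]
  have hx' : (⟨x, hx⟩ : B) ∈ smallClassSet B c := by
    have hfin : (commutator B : Set B).Finite := by
      refine Set.Finite.of_finite_image (f := Subtype.val) ?_ Subtype.val_injective.injOn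
      refine (Set.toFinite ((⁅B, B⁆ : Subgroup H) : Set H)).subset ?_
      rintro _ ⟨y, hy, rfl⟩
      rw [← map_subtype_commutator]
      exact ⟨y, hy, rfl⟩
    refine mem_smallClassSet_of_subset (s := (fun z : B => z * ⟨x, hx⟩) '' (commutator B : Set B))
      (hfin.image _) ?_ ?_
    · refine (Set.ncard_image_le hfin).trans (le_trans ?_ hcard)
      rw [← map_subtype_commutator]
      exact (Nat.card_congr
        ((commutator B).equivMapOfInjective B.subtype B.subtype_injective).toEquiv).le
    · intro g
      exact ⟨⁅g, ⟨x, hx⟩⁆, commutator_mem_commutator (mem_top _) (mem_top _), by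
        simp [commutatorElement_def]⟩
  have h1 := mem_smallClassSet_iff.1 hx'
  have h2 : IndexLE ((centralizer {(⟨x, hx⟩ : B)}).map B.subtype) (c * c) := by
    unfold IndexLE
    rw [index_map_subtype]
    exact ⟨mul_ne_zero h1.1 hB.1, Nat.mul_le_mul h1.2 hB.2⟩
  refine h2.of_le ?_
  rintro _ ⟨y, hy, rfl⟩
  rw [SetLike.mem_coe, mem_centralizer_singleton_iff] at hy
  rw [mem_centralizer_singleton_iff]
  exact congrArg Subtype.val hy

/-- A group with a subgroup of index at most `c` and with commutator subgroup of order at most `c`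
has a characteristic subgroup with these properties up to changing the bound. -/
theorem exists_characteristic_of_indexLE {c : ℕ} {B₀ : Subgroup H} (hB : IndexLE B₀ c)
    [Finite (⁅B₀, B₀⁆ : Subgroup H)] (hcard : Nat.card (⁅B₀, B₀⁆ : Subgroup H) ≤ c) :
    ∃ B : Subgroup H, B.Characteristic ∧ IndexLE B c ∧ Finite (⁅B, B⁆ : Subgroup H) ∧
      Nat.card (⁅B, B⁆ : Subgroup H) ≤ boundedClassesBound ((c * c) ^ (2 * c)) := by
  have hc : 0 < c * c := Nat.mul_pos hB.pos hB.pos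
  have hsub := subset_smallClassSet_of_commutator hB hcard
  have := hB.finiteIndex
  let E : ℕ → Set H := fun j => smallClassSet H ((c * c) ^ j)
  have hE1 : E 1 = smallClassSet H (c * c) := by simp [E]
  have hE : Monotone E := fun i j hij => smallClassSet_mono (Nat.pow_le_pow_right hc hij)
  -- The colours are the cosets of `B₀`: quotients of elements in one coset lie in `B₀`, whose
  -- elements have at most c * c conjugates.
  have hcl : (closure (E 1) : Set H) ⊆ E (2 * Nat.card (H ⧸ B₀)) := by
    refine closure_subset_of_coloring E hE (one_mem_smallClassSet (by simp))
      (fun x hx => inv_mem_smallClassSet hx) (fun j x hx y hy => ?_)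
      (fun x => (QuotientGroup.mk x : H ⧸ B₀)) fun x y hxy => ?_
    · change x * y ∈ smallClassSet H ((c * c) ^ (j + 1))
      rw [pow_succ]
      rw [hE1] at hy
      exact mul_mem_smallClassSet hx hy
    · rw [hE1]
      exact hsub (QuotientGroup.eq.1 hxy)
  rw [hE1] at hcl
  refine ⟨closure (smallClassSet H (c * c)), characteristic_closure_smallClassSet _,
    hB.of_le fun x hx => subset_closure (hsub hx), ?_⟩
  refine finite_commutator_subgroup_of_bounded_classes fun x hx => IndexLE.subgroupOf ?_ _
  exact mem_smallClassSet_iff.1 (hE (Nat.mul_le_mul_left 2 hB.2) (hcl hx))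

/-- The class of each element of `N` stays inside `N`. -/
theorem indexLE_centralizer_of_finite_normal {c : ℕ} (N : Subgroup H) [N.Normal] [Finite N]
    (hN : Nat.card N ≤ c) : IndexLE (centralizer (N : Set H)) (c ^ c) := by
  have hc : 0 < c := Nat.card_pos.trans_le hN
  refine (IndexLE.iInf (f := fun x : N => centralizer {(x : H)}) (fun x => ?_) hc hN).of_le ?_
  · exact mem_smallClassSet_iff.1 (mem_smallClassSet_of_subset (s := (N : Set H)) (Set.toFinite _)
      hN fun g => Normal.conj_mem inferInstance _ x.2 g)
  · intro g hg
    refine mem_centralizer_iff.2 fun x hx => ?_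
    exact (mem_centralizer_singleton_iff.1 (mem_iInf.1 hg ⟨x, hx⟩)).symm

/-- T' lies in B', which T centralizes. -/
theorem nilpotencyClass_inf_centralizer_commutator (B : Subgroup H) :
    ∃ _ : Group.IsNilpotent (B ⊓ centralizer (⁅B, B⁆ : Subgroup H) : Subgroup H),
      Group.nilpotencyClass (B ⊓ centralizer (⁅B, B⁆ : Subgroup H) : Subgroup H) ≤ 2 := by
  set T : Subgroup H := B ⊓ centralizer (⁅B, B⁆ : Subgroup H) with hT
  have hcomm : ∀ x ∈ commutator T, (x : H) ∈ (⁅B, B⁆ : Subgroup H) := by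
    suffices h : commutator T ≤ (⁅B, B⁆ : Subgroup H).subgroupOf T from fun x hx => h hx
    rw [commutator_def]
    exact commutator_le.2 fun x _ y _ => commutator_mem_commutator x.2.1 y.2.1
  have hbot : (⊤ : Subgroup T).lowerCentralSeries 2 = ⊥ := by
    rw [Subgroup.lowerCentralSeries_succ, top_lowerCentralSeries_one, eq_bot_iff]
    refine commutator_le.2 fun x hx y _ => mem_bot.2 ?_
    rw [commutatorElement_eq_one_iff_mul_comm]
    exact Subtype.ext (mem_centralizer_iff.1 y.2.2 x (hcomm x hx))
  have hnil : Group.IsNilpotent T := Subgroup.nilpotent_iff_lowerCentralSeries.2 ⟨2, hbot⟩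
  exact ⟨hnil, Subgroup.lowerCentralSeries_eq_bot_iff_nilpotencyClass_le.1 hbot⟩

end Characteristic

end CommutatorCoverings

theorem mainTheorem2 (k n : ℕ) (hk : 0 < k) (hn : 0 < n) :
    ∃ C : ℕ, ∀ (G : Type*) [Group G], CoveringCondition G k n →
      ∃ B T : Subgroup (commutator G),
        (B.Characteristic ∧ B.index ≠ 0 ∧ B.index ≤ C ∧
          Finite (⁅B, B⁆ : Subgroup (commutator G)) ∧
          Nat.card (⁅B, B⁆ : Subgroup (commutator G)) ≤ C) ∧
        T = B ⊓ Subgroup.centralizer (⁅B, B⁆ : Subgroup (commutator G)) ∧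
        T.Characteristic ∧
        (∃ _ : Group.IsNilpotent T, Group.nilpotencyClass T ≤ 2) ∧
        T.index ≠ 0 ∧ T.index ≤ C := by
  obtain ⟨c, hc⟩ := CoveringCondition.exists_subgroup_commutator k n hn
  let b := boundedClassesBound ((c * c) ^ (2 * c))
  refine ⟨c + b + c * b ^ b, fun G _ hG => ?_⟩
  obtain ⟨B₀, hB₀, hfin₀, hcard₀⟩ := hc G hG
  obtain ⟨B, hchar, hB, hfin, hcard⟩ := exists_characteristic_of_indexLE hB₀ hcard₀
  have hT := hB.inf (indexLE_centralizer_of_finite_normal ⁅B, B⁆ hcard)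
  exact ⟨B, _, ⟨hchar, hB.1, hB.2.trans (by lia), hfin, hcard.trans (by lia)⟩, rfl, inferInstance,
    nilpotencyClass_inf_centralizer_commutator B, hT.1, hT.2.trans (Nat.le_add_left _ _)⟩
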